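/- Let $\Bbbk$ be an algebraically closed field of arbitrary characteristic, let $N>0$, $V=\Bbbk^N$, $G=\mathrm{GL}_N(\Bbbk)$ and $\mathfrak g=\mathfrak{gl}_N(\Bbbk)$. For a partition $\nu$ of $N$, let $\mathcal O_\nu\subseteq\mathfrak g$ be the $G$-orbit of nilpotent matrices whose Jordan blocks have sizes the parts of $\nu$. Let $\lambda=(\lambda_1,\dots,\lambda_n)$ be a composition of $N$ into positive integers, let $V=\bigoplus_{i=1}^n V_i$ be any decomposition with $\dim V_i=\lambda_i$, and let $\mathfrak g_\lambda=\{x\in\mathfrak g : xV_i\subseteq V_i \text{ for all } i\}\cong\bigoplus_{i=1}^n\mathfrak{gl}_{\lambda_i}$ be the corresponding Levi subalgebra. For each $i$ let $\mu_i=(\mu_{i,1}\ge\mu_{i,2}\ge\cdots)$ be a partition of $\lambda_i$, with $\mu_{i,j}=0$ beyond the last part, and let $\mathcal O_\mu\subseteq\mathfrak g_\lambda$ be the nilpotent orbit consisting of those $x\in\mathfrak g_\lambda$ for which each $x|_{V_i}$ is nilpotent with Jordan blocks of sizes the parts of $\mu_i$. Let $\mu^\Sigma$ be the partition of $N$ with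 parts $\mu^\Sigma_j=\sum_{i=1}^n\mu_{i,j}$, $j\ge1$ (zeros omitted). Let $\mathfrak p\subseteq\mathfrak g$ be any parabolic subalgebra (the stabilizer of a flag $0=F_0\subsetneq F_1\subsetneq\cdots\subsetneq F_r=V$) that has $\mathfrak g_\lambda$ as a Levi factor, i.e. $\mathfrak p=\mathfrak g_\lambda\oplus\mathfrak n$, where $\mathfrak n=\{x\in\mathfrak g : xF_k\subseteq F_{k-1}\text{ for }1\le k\le r\}$ is the nilradical of $\mathfrak p$ (the Lie algebra of the unipotent radical of the corresponding parabolic subgroup). The induced orbit $\operatorname{Ind}_{\mathfrak g_\lambda}^{\mathfrak g}(\mathcal O_\mu)$ is the unique Zariski dense $G$-orbit contained in $\operatorname{Ad}(G)(\mathcal O_\mu+\mathfrak n)$. Then this unique dense orbit exists and has partition $\mu^\Sigma$; that is, $\operatorname{Ind}_{\mathfrak g_\lambda}^{\mathfrak g}(\mathcal O_\mu)=\mathcal O_{\mu^\Sigma}$, independently of the choice of $\mathfrak p$. -/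

import Mathlib

namespace InducedOrbit

attribute [local instance] LieRing.ofAssociativeRing

/-! ### Partitions -/

/-- The `j`-th part (counted from `0`) of a partition whose parts are listed in non-increasing
order, with value `0` beyond the last part. -/
def part {n : ℕ} (p : Nat.Partition n) (j : ℕ) : ℕ :=
  (p.parts.sort (· ≥ ·)).getD j 0

theorem sum_range_getD (l : List ℕ) (N : ℕ) (h : l.length ≤ N) :
    ∑ j ∈ Finset.range N, l.getD j 0 = l.sum := by
  induction l generalizing N with
  | nil => simp
  | cons a t ih =>
    obtain ⟨M, rfl⟩ : ∃ M, N = M + 1 := ⟨N - 1, by simp at h; omega⟩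
    rw [Finset.sum_range_succ']
    simp only [List.getD_cons_succ, List.getD_cons_zero, List.sum_cons]
    rw [ih M (by simpa using h), add_comm]

theorem sum_range_part {n N : ℕ} (p : Nat.Partition n) (h : n ≤ N) :
    ∑ j ∈ Finset.range N, part p j = n := by
  have hs : (p.parts.sort (· ≥ ·)).sum = n := by
    rw [← Multiset.sum_coe, Multiset.sort_eq, p.parts_sum]
  have hl : (p.parts.sort (· ≥ ·)).length ≤ n := by
    have := Multiset.card_nsmul_le_sum (s := p.parts) (a := 1) (fun x hx => p.parts_pos hx)
    rw [p.parts_sum] at this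
    simpa using this
  unfold part
  rw [sum_range_getD _ N (hl.trans h), hs]

/-- The partition `μ^Σ` of `N`: for a composition `c = (λ_1, …, λ_n)` of `N` and partitions
`μ_i` of `λ_i`, its parts are the columnwise sums `μ^Σ_j = ∑ i, μ_{i,j}`.  (Since the `μ_i` have
at most `N` parts, indices `j < N` suffice; the zero sums are discarded by `ofSums`.) -/
def sigmaPartition {N : ℕ} (c : Composition N)
    (μ : (i : Fin c.length) → Nat.Partition (c.blocksFun i)) : Nat.Partition N :=
  Nat.Partition.ofSums N ((Multiset.range N).map fun j => ∑ i, part (μ i) j) (by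
    change ∑ j ∈ Finset.range N, ∑ i, part (μ i) j = N
    rw [Finset.sum_comm,
      Finset.sum_congr rfl fun i _ => sum_range_part (μ i) (c.blocksFun_le i)]
    exact c.sum_blocksFun)

/-! ### Nilpotent orbits of general linear Lie algebras -/

/-- `x` has a Jordan basis with nilpotent blocks of sizes `a i` (blocks of size `0` are empty):
a basis `b i k`, `k < a i`, with `x (b i 0) = 0` and `x (b i (k + 1)) = b i k`. -/
def HasJordanBlocks {K V ι : Type*} [Field K] [AddCommGroup V] [Module K V]
    (x : Module.End K V) (a : ι → ℕ) : Prop :=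
  ∃ b : Module.Basis ((i : ι) × Fin (a i)) K V,
    (∀ (i : ι) (h : 0 < a i), x (b ⟨i, ⟨0, h⟩⟩) = 0) ∧
    ∀ (i : ι) (k : ℕ) (h : k + 1 < a i),
      x (b ⟨i, ⟨k + 1, h⟩⟩) = b ⟨i, ⟨k, (Nat.lt_succ_self k).trans h⟩⟩

/-- The nilpotent orbit `O_p ⊆ gl(V)` of a partition `p`: the endomorphisms whose Jordan blocks are
nilpotent with sizes the parts of `p`. -/
def nilpotentOrbit (K V : Type*) [Field K] [AddCommGroup V] [Module K V] {n : ℕ}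
    (p : Nat.Partition n) : Set (Module.End K V) :=
  {x | HasJordanBlocks x (part p)}

/-- `Ad(GL(V))(S)`, the union of the `GL(V)`-conjugates of `S ⊆ gl(V)`. -/
def adSaturation {K V : Type*} [Field K] [AddCommGroup V] [Module K V]
    (S : Set (Module.End K V)) : Set (Module.End K V) :=
  {y | ∃ g : LinearMap.GeneralLinearGroup K V, ∃ x ∈ S,
    y = (g : Module.End K V) * x * ((g⁻¹ : LinearMap.GeneralLinearGroup K V) : Module.End K V)}

/-- `O` is an orbit of `GL(V)` acting on `gl(V)` by conjugation. -/
def IsAdOrbit {K V : Type*} [Field K] [AddCommGroup V] [Module K V]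
    (O : Set (Module.End K V)) : Prop :=
  ∃ x : Module.End K V, O = adSaturation {x}

/-! ### Levi and parabolic subalgebras -/

/-- The Lie subalgebra of `gl(V)` of the endomorphisms preserving every member of a family of
subspaces. For the summands of a direct sum decomposition it is a Levi subalgebra of `gl(V)`, for
the members of a flag it is a parabolic subalgebra. -/
def stabilizer {K V ι : Type*} [Field K] [AddCommGroup V] [Module K V]
    (W : ι → Submodule K V) : LieSubalgebra K (Module.End K V) where
  carrier := {x | ∀ i, ∀ v ∈ W i, x v ∈ W i}
  add_mem' := fun ha hb i v hv => (W i).add_mem (ha i v hv) (hb i v hv)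
  zero_mem' := fun i _ _ => (W i).zero_mem
  smul_mem' := fun c _ hx i v hv => (W i).smul_mem c (hx i v hv)
  lie_mem' := fun {_ _} hx hy i v hv =>
    (W i).sub_mem (hx i _ (hy i v hv)) (hy i _ (hx i v hv))

/-- For a decomposition `V = ⨁ W i` with Levi subalgebra `stabilizer W = ⨁ gl(W i)`, the nilpotent
orbit `O_μ` of this Levi subalgebra whose projection to each `gl(W i)` is the nilpotent orbit of
the partition `μ i`. -/
def leviNilpotentOrbit {K V ι : Type*} [Field K] [AddCommGroup V] [Module K V]
    (W : ι → Submodule K V) {d : ι → ℕ} (μ : (i : ι) → Nat.Partition (d i)) :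
    Set (Module.End K V) :=
  {x | ∃ hx : x ∈ stabilizer W,
    ∀ i, LinearMap.restrict x (hx i) ∈ nilpotentOrbit K (W i) (μ i)}

/-- A (partial) flag `0 = F_0 ⊂ F_1 ⊂ ⋯ ⊂ F_r = V`. -/
structure PartialFlag (K V : Type*) [Field K] [AddCommGroup V] [Module K V] where
  len : ℕ
  space : Fin (len + 1) → Submodule K V
  strictMono : StrictMono space
  space_zero : space 0 = ⊥
  space_last : space (Fin.last len) = ⊤

/-- The parabolic subalgebra of `gl(V)` attached to a flag: its stabilizer. -/
def PartialFlag.parabolic {K V : Type*} [Field K] [AddCommGroup V] [Module K V]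
    (F : PartialFlag K V) : LieSubalgebra K (Module.End K V) :=
  stabilizer F.space

/-- The nilradical `𝔫` of the parabolic subalgebra of a flag, i.e. the Lie algebra of the unipotent
radical of the parabolic subgroup: the endomorphisms mapping `F_{i+1}` into `F_i`. -/
def PartialFlag.nilradical {K V : Type*} [Field K] [AddCommGroup V] [Module K V]
    (F : PartialFlag K V) : LieSubalgebra K (Module.End K V) where
  carrier := {x | ∀ i : Fin F.len, ∀ v ∈ F.space i.succ, x v ∈ F.space i.castSucc}
  add_mem' := fun ha hb i v hv => (F.space _).add_mem (ha i v hv) (hb i v hv)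
  zero_mem' := fun i _ _ => (F.space _).zero_mem
  smul_mem' := fun c _ hx i v hv => (F.space _).smul_mem c (hx i v hv)
  lie_mem' := fun {x y} hx hy i v hv => by
    have hle := F.strictMono.monotone (Fin.castSucc_lt_succ (i := i)).le
    exact (F.space _).sub_mem (hx i _ (hle (hy i v hv))) (hy i _ (hle (hx i v hv)))

/-- The parabolic subalgebra `𝔭` of the flag `F` admits the Levi subalgebra `𝔤₀` as a Levi factor:
`𝔭 = 𝔤₀ ⊕ 𝔫` as vector spaces. -/
def IsLeviFactor {K V : Type*} [Field K] [AddCommGroup V] [Module K V]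
    (𝔤₀ : LieSubalgebra K (Module.End K V)) (F : PartialFlag K V) : Prop :=
  𝔤₀.toSubmodule ⊓ F.nilradical.toSubmodule = ⊥ ∧
    𝔤₀.toSubmodule ⊔ F.nilradical.toSubmodule = F.parabolic.toSubmodule

/-! ### Induced orbits -/

/-- The Zariski closure of a subset `S` of a vector space `E`: the common zeros of all polynomial
functions (polynomials in the linear forms on `E`) that vanish on `S`. -/
def zariskiClosure (K : Type*) {E : Type*} [Field K] [AddCommGroup E] [Module K E]
    (S : Set E) : Set E :=
  {x | ∀ f : MvPolynomial (Module.Dual K E) K,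
    (∀ y ∈ S, MvPolynomial.eval (fun φ : Module.Dual K E => φ y) f = 0) →
      MvPolynomial.eval (fun φ : Module.Dual K E => φ x) f = 0}

/-- `O` is a `GL(V)`-orbit which is Zariski dense in `Ad(GL(V))(O₀ + 𝔫)`, where `O₀` is a nilpotent
orbit in a Levi factor of the parabolic subalgebra of the flag `F` and `𝔫` is its nilradical. -/
def IsInducedOrbit {K V : Type*} [Field K] [AddCommGroup V] [Module K V]
    (F : PartialFlag K V) (O₀ O : Set (Module.End K V)) : Prop :=
  IsAdOrbit O ∧
    O ⊆ adSaturation {z | ∃ x ∈ O₀, ∃ y ∈ F.nilradical, z = x + y} ∧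
    adSaturation {z | ∃ x ∈ O₀, ∃ y ∈ F.nilradical, z = x + y} ⊆ zariskiClosure K O

end InducedOrbit

/-! A nilpotent endomorphism is determined up to conjugation by the ranks of its powers: type `p`
means that `x ^ k` has rank `∑ j, (p_j - k)` with truncated subtraction (`mem_nilpotentOrbit_iff`).
The theorem thus becomes a statement about ranks on the cosets `x + 𝔫`, `x ∈ O_μ`.

The Levi condition forces the flag to consist of sums of initial segments of the `W i` in some order
(`exists_flag_order`), so `𝔫` consists of the strictly block triangular endomorphisms. Let `z ∈ x +
𝔫`.

Upper bound: spending `κ_i` factors of `z` on the `i`-th block gives `rank z ^ (∑ κ_i) ≤ ∑ rank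
(x|W_i) ^ κ_i` (`finrank_map_pow_sum_le`). Since the `μ_i` are non-increasing, `κ` with `∑ κ_i ≤ k`
can be chosen so that truncating each `μ_i` by `κ_i` and summing equals truncating the column sums
by `k` (`exists_sum_le_forall_sum_sub`). This is the rank of the `k`-th power for `μ^Σ`.

Attainment: linking the `j`-th Jordan chains of all the blocks end to end changes `x` only by an
element of `𝔫` and gives type `μ^Σ` (`exists_hasJordanBlocks_sum`).

Density: `rank z ^ k ≥ r` is a Zariski open condition. On a line in `x + 𝔫` through a point of type
`μ^Σ`, all but finitely many points have maximal ranks, hence type `μ^Σ`; as `K` is infinite, the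
whole line lies in the closure. Semicontinuity of ranks gives uniqueness, and the column sums do not
see the order of the blocks. -/

namespace InducedOrbit

attribute [local instance] LieRing.ofAssociativeRing

open Module

/-! ### Jordan bases and ranks of powers -/

section Jordan

variable {K V ι ι' : Type*} [Field K] [AddCommGroup V] [Module K V]

theorem pow_apply_jordanBasis {x : End K V} {a : ι → ℕ}
    (b : Basis ((i : ι) × Fin (a i)) K V)
    (h0 : ∀ (i : ι) (h : 0 < a i), x (b ⟨i, ⟨0, h⟩⟩) = 0)
    (h1 : ∀ (i : ι) (k : ℕ) (h : k + 1 < a i),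
      x (b ⟨i, ⟨k + 1, h⟩⟩) = b ⟨i, ⟨k, (Nat.lt_succ_self k).trans h⟩⟩)
    (k : ℕ) (i : ι) (l : ℕ) (hl : l < a i) :
    (x ^ k) (b ⟨i, ⟨l, hl⟩⟩) =
      if k ≤ l then b ⟨i, ⟨l - k, (Nat.sub_le l k).trans_lt hl⟩⟩ else 0 := by
  induction k generalizing l with
  | zero => simp
  | succ k ih =>
    rw [pow_succ, Module.End.mul_apply]
    cases l with
    | zero => simp [h0 i hl]
    | succ l => simp [h1 i l hl, ih]

/-- The `k`-th power shifts every chain down by `k`, so its range is spanned by the first `a i - k`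
vectors of each chain. -/
theorem HasJordanBlocks.finrank_range_pow [FiniteDimensional K V] {x : End K V} {a : ι → ℕ}
    (h : HasJordanBlocks x a) (k : ℕ) :
    finrank K (LinearMap.range (x ^ k)) = Nat.card ((i : ι) × Fin (a i - k)) := by
  obtain ⟨b, h0, h1⟩ := h
  have hpow := pow_apply_jordanBasis b h0 h1 k
  have : Finite ((i : ι) × Fin (a i)) := Module.Finite.finite_basis b
  let f : ((i : ι) × Fin (a i - k)) → ((i : ι) × Fin (a i)) :=
    fun p => ⟨p.1, ⟨p.2, p.2.2.trans_le (Nat.sub_le _ _)⟩⟩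
  have hf : Function.Injective f := by
    rintro ⟨i, l⟩ ⟨j, m⟩ h
    obtain rfl : i = j := congrArg Sigma.fst h
    simpa [f, Fin.ext_iff] using h
  have : Finite ((i : ι) × Fin (a i - k)) := Finite.of_injective f hf
  have := Fintype.ofFinite ((i : ι) × Fin (a i - k))
  have hrange : LinearMap.range (x ^ k) = Submodule.span K (Set.range (b ∘ f)) := by
    rw [LinearMap.range_eq_map, ← b.span_eq, Submodule.map_span]
    apply le_antisymm <;> rw [Submodule.span_le]
    · rintro _ ⟨_, ⟨⟨i, l, hl⟩, rfl⟩, rfl⟩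
      rw [hpow]
      split_ifs with hk
      · exact Submodule.subset_span ⟨⟨i, ⟨l - k, by omega⟩⟩, rfl⟩
      · exact Submodule.zero_mem _
    · rintro _ ⟨⟨i, l, hl⟩, rfl⟩
      refine Submodule.subset_span ⟨_, ⟨⟨i, ⟨l + k, by omega⟩⟩, rfl⟩, ?_⟩
      rw [hpow]
      simp [f]
  rw [hrange, finrank_span_eq_card (b.linearIndependent.comp f hf), Nat.card_eq_fintype_card]

/-- Empty blocks carry no basis vectors, so they may be added or dropped. This allows families
indexed by `Fin d` and by `ℕ` to be compared. -/
theorem hasJordanBlocks_comp_iff {x : End K V} {a : ι → ℕ} {f : ι' → ι}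
    (hf : Function.Injective f) (ha : ∀ i, 0 < a i → i ∈ Set.range f) :
    HasJordanBlocks x (a ∘ f) ↔ HasJordanBlocks x a := by
  let g : ((i : ι') × Fin ((a ∘ f) i)) → ((i : ι) × Fin (a i)) := fun p => ⟨f p.1, p.2⟩
  have hg : Function.Bijective g := by
    refine ⟨?_, ?_⟩
    · rintro ⟨i, l⟩ ⟨j, m⟩ h
      obtain rfl : i = j := hf (congrArg Sigma.fst h)
      simpa [g] using h
    rintro ⟨i, l⟩
    obtain ⟨j, rfl⟩ := ha i l.pos
    exact ⟨⟨j, l⟩, rfl⟩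
  let e := Equiv.ofBijective g hg
  constructor
  · rintro ⟨b, h0, h1⟩
    have he (i : ι') (l : Fin (a (f i))) : b.reindex e ⟨f i, l⟩ = b ⟨i, l⟩ := by
      rw [Basis.reindex_apply]
      exact congrArg b (e.symm_apply_apply ⟨i, l⟩)
    refine ⟨b.reindex e, fun i h => ?_, fun i k h => ?_⟩
    · obtain ⟨j, rfl⟩ := ha i h
      rw [he, h0]
    · obtain ⟨j, rfl⟩ := ha i (Nat.zero_lt_of_lt h)
      rw [he, he]
      exact h1 j k h
  · rintro ⟨b, h0, h1⟩
    have he (i : ι') (l : Fin (a (f i))) : b.reindex e.symm ⟨i, l⟩ = b ⟨f i, l⟩ := by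
      rw [Basis.reindex_apply]; rfl
    refine ⟨b.reindex e.symm, fun i h => ?_, fun i k h => ?_⟩
    · exact (congrArg x (he _ _)).trans (h0 (f i) h)
    · exact (congrArg x (he _ _)).trans ((h1 (f i) k h).trans (he _ _).symm)

/-- The blocks of size greater than `k` are counted by the drop between consecutive truncated
sums. -/
theorem card_sigma_sub (a : ι → ℕ) [Finite ((i : ι) × Fin (a i))] (k : ℕ) :
    Nat.card ((i : ι) × Fin (a i - k)) =
      Nat.card ((i : ι) × Fin (a i - (k + 1))) + Nat.card {i // k < a i} := by
  have hfin (m : ℕ) : Finite ((i : ι) × Fin (a i - m)) :=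
    Finite.of_injective (fun p => (⟨p.1, ⟨p.2, p.2.2.trans_le (Nat.sub_le _ _)⟩⟩ :
      (i : ι) × Fin (a i))) (by
        rintro ⟨i, l⟩ ⟨j, m⟩ h
        obtain rfl : i = j := congrArg Sigma.fst h
        simpa [Fin.ext_iff] using h)
  have hfin' : Finite {i // k < a i} :=
    Finite.of_injective (fun p => (⟨p.1, ⟨k, p.2⟩⟩ : (i : ι) × Fin (a i))) (by
        rintro ⟨i, l⟩ ⟨j, m⟩ h
        exact Subtype.ext (congrArg Sigma.fst h))
  rw [← Nat.card_sum]
  refine (Nat.card_congr (Equiv.ofBijective (Sum.elim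
    (fun p : (i : ι) × Fin (a i - (k + 1)) =>
      (⟨p.1, ⟨p.2 + 1, by omega⟩⟩ : (i : ι) × Fin (a i - k)))
    (fun p : {i // k < a i} => ⟨p.1, ⟨0, by have := p.2; omega⟩⟩)) ⟨?_, ?_⟩)).symm
  · rintro (⟨i, l⟩ | ⟨i, h⟩) (⟨j, m⟩ | ⟨j, h'⟩) h <;>
      obtain rfl : i = j := congrArg Sigma.fst h <;> simp [Fin.ext_iff] at h ⊢
    exact h
  · rintro ⟨i, _ | l, hl⟩
    · exact ⟨Sum.inr ⟨i, by omega⟩, rfl⟩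
    · exact ⟨Sum.inl ⟨i, ⟨l, by omega⟩⟩, rfl⟩

theorem finite_pos_of_finite_sigma (a : ι → ℕ) [Finite ((i : ι) × Fin (a i))] :
    Finite {i // 0 < a i} :=
  Finite.of_injective (fun p => (⟨p.1, ⟨0, p.2⟩⟩ : (i : ι) × Fin (a i))) (by
    rintro ⟨i, l⟩ ⟨j, m⟩ h
    exact Subtype.ext (congrArg Sigma.fst h))

theorem card_fiber_add_card_lt (a : ι → ℕ) [Finite ((i : ι) × Fin (a i))] (m : ℕ) (hm : 0 < m) :
    Nat.card {i : {i // 0 < a i} // a i = m} + Nat.card {i // m < a i} =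
      Nat.card {i // m - 1 < a i} := by
  have := finite_pos_of_finite_sigma a
  have h1 : Finite {i // m < a i} := Finite.of_injective
    (fun p => (⟨p.1, hm.trans p.2⟩ : {i // 0 < a i}))
    (fun p q h => Subtype.ext (congrArg (fun r : {i // 0 < a i} => r.1) h))
  rw [← Nat.card_sum]
  refine Nat.card_congr (Equiv.ofBijective (Sum.elim
    (fun p : {i : {i // 0 < a i} // a i = m} =>
      (⟨p.1.1, by rw [p.2]; omega⟩ : {i // m - 1 < a i}))
    (fun p : {i // m < a i} => ⟨p.1, by have := p.2; omega⟩)) ⟨?_, ?_⟩)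
  · rintro (⟨⟨i, hi⟩, l⟩ | ⟨i, l⟩) (⟨⟨j, hj⟩, l'⟩ | ⟨j, l'⟩) h <;>
      obtain rfl : i = j := congrArg Subtype.val h
    · rfl
    · change a i = m at l; omega
    · change a i = m at l'; omega
    · rfl
  · rintro ⟨i, hi⟩
    by_cases him : a i = m
    · exact ⟨Sum.inl ⟨⟨i, by omega⟩, him⟩, rfl⟩
    · exact ⟨Sum.inr ⟨i, by omega⟩, rfl⟩

/-- First differences in `k` count the blocks larger than `k`, second differences the blocks of each
exact positive size; hence the nonempty blocks of both families match up. -/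
theorem HasJordanBlocks.of_card_eq {x : End K V} {a : ι → ℕ} {a' : ι' → ℕ}
    [Finite ((i : ι) × Fin (a i))] [Finite ((i : ι') × Fin (a' i))]
    (h : ∀ k, Nat.card ((i : ι) × Fin (a i - k)) = Nat.card ((i : ι') × Fin (a' i - k)))
    (hx : HasJordanBlocks x a) : HasJordanBlocks x a' := by
  have hcard (k : ℕ) : Nat.card {i // k < a i} = Nat.card {i // k < a' i} := by
    have h1 := card_sigma_sub a k
    have h2 := card_sigma_sub a' k
    rw [h, h] at h1
    omega
  have hequiv (m : ℕ) :
      Nonempty ({i : {i // 0 < a i} // a i = m} ≃ {i : {i // 0 < a' i} // a' i = m}) := by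
    have := finite_pos_of_finite_sigma a
    have := finite_pos_of_finite_sigma a'
    rw [← Finite.card_eq]
    rcases Nat.eq_zero_or_pos m with rfl | hm
    · have h1 : IsEmpty {i : {i // 0 < a i} // a i = 0} := ⟨fun p => by
        have := p.1.2; have := p.2; omega⟩
      have h2 : IsEmpty {i : {i // 0 < a' i} // a' i = 0} := ⟨fun p => by
        have := p.1.2; have := p.2; omega⟩
      simp
    · have h1 := card_fiber_add_card_lt a m hm
      have h2 := card_fiber_add_card_lt a' m hm
      rw [hcard, hcard] at h1
      omega
  let e := fun m => (hequiv m).some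
  -- The bijections between blocks of equal size are glued along the size map.
  let E : {i // 0 < a i} ≃ {i // 0 < a' i} :=
    (Equiv.sigmaFiberEquiv fun i : {i // 0 < a i} => a i).symm.trans
      ((Equiv.sigmaCongrRight e).trans (Equiv.sigmaFiberEquiv fun i : {i // 0 < a' i} => a' i))
  have hE (i : {i // 0 < a i}) : a' (E i) = a i := (e (a i) ⟨i, rfl⟩).2
  rw [← hasJordanBlocks_comp_iff (f := fun i : {i // 0 < a i} => i.1) Subtype.val_injective
    fun i hi => ⟨⟨i, hi⟩, rfl⟩] at hx
  rw [← hasJordanBlocks_comp_iff (f := fun i : {i // 0 < a i} => (E i).1)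
    (Subtype.val_injective.comp E.injective)
    fun i hi => ⟨E.symm ⟨i, hi⟩, by simp⟩]
  convert hx using 1
  exact funext hE

theorem dfinsuppBasis_apply [DecidableEq ι] {M : ι → Type*} {η : ι → Type*}
    [∀ i, AddCommGroup (M i)] [∀ i, Module K (M i)] (c : ∀ i, Basis (η i) K (M i)) (i : ι)
    (l : η i) : DFinsupp.basis c ⟨i, l⟩ = DFinsupp.single i (c i l) := by
  rw [Basis.apply_eq_iff]
  change sigmaFinsuppEquivDFinsupp.symm
    (DFinsupp.mapRange (fun i x => (c i).repr x) (fun i => map_zero _) (DFinsupp.single i (c i l))) = _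
  rw [DFinsupp.mapRange_single, Equiv.symm_apply_eq]
  simp

open Polynomial in
theorem exists_basis_quotient_X_pow (K : Type*) [Field K] (k : ℕ) :
    ∃ c : Basis (Fin k) K (K[X] ⧸ (K[X] ∙ (X ^ k : K[X]))),
      ∀ i, c i = Submodule.Quotient.mk (X ^ (i : ℕ)) := by
  let B := (AdjoinRoot.powerBasis' (monic_X_pow (R := K) k))
  have hd : B.dim = k := by simp [B]
  refine ⟨B.basis.reindex (finCongr hd), fun i => ?_⟩
  refine (Basis.reindex_apply B.basis (finCongr hd) i).trans ?_
  rw [PowerBasis.basis_eq_pow]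
  simp only [B, AdjoinRoot.powerBasis'_gen]
  rfl

open Polynomial DirectSum in
/-- Every nilpotent endomorphism has a Jordan basis. -/
theorem exists_hasJordanBlocks_of_isNilpotent [FiniteDimensional K V] {x : End K V}
    (hx : IsNilpotent x) : ∃ (d : ℕ) (a : Fin d → ℕ), HasJordanBlocks x a := by
  obtain ⟨n, hn⟩ := hx
  -- `V` becomes a `K[X]`-module killed by `X ^ n`, so the structure theorem over a PID splits it
  -- into summands `K[X] / (X ^ a i)`.
  have htor : Module.IsTorsion' (AEval' x) (Submonoid.powers (X : K[X])) := by
    intro m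
    refine ⟨⟨X ^ n, n, rfl⟩, ?_⟩
    obtain ⟨v, rfl⟩ := (AEval'.of x).surjective m
    change (X ^ n : K[X]) • AEval'.of x v = 0
    rw [AEval'.X_pow_smul_of, hn]
    simp
  obtain ⟨d, a, ⟨e⟩⟩ := Module.torsion_by_prime_power_decomposition irreducible_X htor
  choose c hc using fun i => exists_basis_quotient_X_pow K (a i)
  refine ⟨d, a, ?_⟩
  let e' : V ≃ₗ[K] ⨁ i : Fin d, K[X] ⧸ (K[X] ∙ (X ^ (a i) : K[X])) :=
    (AEval'.of x).trans (e.restrictScalars K)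
  have hex (v : V) : e' (x v) = (X : K[X]) • e' v := by
    change e (AEval'.of x (x v)) = _
    rw [← AEval'.X_smul_of, map_smul]
    rfl
  -- Multiplication by `X` raises exponents while a Jordan basis lowers its index, so the monomials
  -- are listed in reverse: index `l` carries `X ^ (a i - 1 - l)`.
  let B : Basis ((i : Fin d) × Fin (a i)) K V :=
    ((DFinsupp.basis c).map e'.symm).reindex (Equiv.sigmaCongrRight fun i => Fin.revPerm)
  have hB (i : Fin d) (l : Fin (a i)) :
      e' (B ⟨i, l⟩) = DirectSum.of _ i (Submodule.Quotient.mk (X ^ (a i - 1 - l))) := by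
    simp only [B, Basis.reindex_apply, Basis.map_apply, LinearEquiv.apply_symm_apply]
    refine (dfinsuppBasis_apply c i l.rev).trans ?_
    rw [hc, Fin.val_rev, add_comm, Nat.sub_add_eq]
    rfl
  have hX (i : Fin d) (l : Fin (a i)) :
      e' (x (B ⟨i, l⟩)) = DirectSum.of _ i (Submodule.Quotient.mk (X ^ (a i - 1 - l + 1))) := by
    rw [hex, hB, ← DirectSum.lof_eq_of K[X], ← map_smul, pow_succ']
    rfl
  refine ⟨B, fun i h => e'.injective ?_, fun i k h => e'.injective ?_⟩
  · rw [hX, map_zero, (Submodule.Quotient.mk_eq_zero _).2, map_zero]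
    refine Submodule.mem_span_singleton.2 ⟨1, ?_⟩
    rw [one_smul]
    congr 1
    simp only
    omega
  · rw [hX, hB]
    congr 4
    simp only
    omega

end Jordan

/-! ### Truncated sums of partitions -/

section Partition

theorem sum_range_getD_comp (f : ℕ → ℕ) (hf : f 0 = 0) (l : List ℕ) (M : ℕ) (h : l.length ≤ M) :
    ∑ j ∈ Finset.range M, f (l.getD j 0) = (l.map f).sum := by
  rw [← sum_range_getD (l.map f) M (by simpa using h)]
  refine Finset.sum_congr rfl fun j _ => ?_
  simp only [List.getD_eq_getElem?_getD, List.getElem?_map]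
  cases l[j]? <;> simp [hf]

theorem card_parts_le {n : ℕ} (p : Nat.Partition n) : p.parts.card ≤ n := by
  have := Multiset.card_nsmul_le_sum (s := p.parts) (a := 1) (fun x hx => p.parts_pos hx)
  rwa [p.parts_sum, smul_eq_mul, mul_one] at this

theorem sum_range_part_comp (f : ℕ → ℕ) (hf : f 0 = 0) {n M : ℕ} (p : Nat.Partition n)
    (h : n ≤ M) : ∑ j ∈ Finset.range M, f (part p j) = (p.parts.map f).sum := by
  unfold part
  rw [sum_range_getD_comp f hf _ M (by simpa using (card_parts_le p).trans h),
    ← Multiset.sum_coe, ← Multiset.map_coe, Multiset.sort_eq]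

theorem part_eq_zero {n : ℕ} (p : Nat.Partition n) {j : ℕ} (h : n ≤ j) : part p j = 0 := by
  unfold part
  exact List.getD_eq_default _ _ (by simpa using (card_parts_le p).trans h)

theorem part_antitone {n : ℕ} (p : Nat.Partition n) : Antitone (part p) := by
  intro i j hij
  unfold part
  by_cases hj : j < (p.parts.sort (· ≥ ·)).length
  · rw [List.getD_eq_getElem _ _ hj, List.getD_eq_getElem _ _ (hij.trans_lt hj)]
    rcases hij.eq_or_lt with rfl | hlt
    · exact le_rfl
    · exact List.pairwise_iff_getElem.1 (Multiset.pairwise_sort p.parts (· ≥ ·)) i j _ hj hlt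
  · rw [List.getD_eq_default _ _ (not_lt.1 hj)]
    exact Nat.zero_le _

theorem part_le {n : ℕ} (p : Nat.Partition n) (j : ℕ) : part p j ≤ n := by
  by_cases h : j < n
  · conv_rhs => rw [← sum_range_part p le_rfl]
    exact Finset.single_le_sum (f := part p) (fun _ _ => Nat.zero_le _) (Finset.mem_range.2 h)
  · rw [part_eq_zero p (not_lt.1 h)]
    exact Nat.zero_le _

/-- Sorting the column sums and discarding zeros does not change the truncated sum, because `0 - k =
0`. -/
theorem sum_part_sigmaPartition {N : ℕ} (c : Composition N)
    (μ : (i : Fin c.length) → Nat.Partition (c.blocksFun i)) (k : ℕ) :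
    ∑ j ∈ Finset.range N, (part (sigmaPartition c μ) j - k) =
      ∑ j ∈ Finset.range N, (∑ i, part (μ i) j - k) := by
  rw [sum_range_part_comp (· - k) (Nat.zero_sub k) _ le_rfl]
  have h (s : Multiset ℕ) : ((s.filter (· ≠ 0)).map (· - k)).sum = (s.map (· - k)).sum := by
    induction s using Multiset.induction_on with
    | empty => rfl
    | cons a s ih =>
      simp only [ne_eq] at ih
      by_cases ha : a = 0 <;> simp [ha, ih]
  change (((((Multiset.range N).map fun j => ∑ i, part (μ i) j).filter (· ≠ 0))).map (· - k)).sum =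
    (((Multiset.range N)).map fun j => ∑ i, part (μ i) j - k).sum
  rw [h, Multiset.map_map]
  rfl

/-- A function with finite support on `ℕ` indexes a finite family of blocks. -/
def sigmaFinEquiv (a : ℕ → ℕ) (M : ℕ) (h : ∀ j, M ≤ j → a j = 0) :
    ((j : ℕ) × Fin (a j)) ≃ ((j : Fin M) × Fin (a j)) where
  toFun p := ⟨⟨p.1, by
    by_contra hp
    have := p.2.pos
    rw [h _ (not_lt.1 hp)] at this
    exact lt_irrefl _ this⟩, p.2⟩
  invFun p := ⟨p.1, p.2⟩
  left_inv _ := rfl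
  right_inv _ := rfl

theorem card_sigma_nat (a : ℕ → ℕ) (M : ℕ) (h : ∀ j, M ≤ j → a j = 0) :
    Nat.card ((j : ℕ) × Fin (a j)) = ∑ j ∈ Finset.range M, a j := by
  rw [Nat.card_congr (sigmaFinEquiv a M h), Nat.card_eq_fintype_card, Fintype.card_sigma,
    ← Fin.sum_univ_eq_sum_range]
  simp

theorem finite_sigma_nat (a : ℕ → ℕ) (M : ℕ) (h : ∀ j, M ≤ j → a j = 0) :
    Finite ((j : ℕ) × Fin (a j)) :=
  Finite.of_equiv _ (sigmaFinEquiv a M h).symm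

/-- Given integer intervals `[l i, u i]`, every integer between `∑ l` and `∑ u` is a sum of
elements of the intervals. -/
theorem exists_sum_eq_of_le_of_le {ι : Type*} [Fintype ι] (l u : ι → ℕ) (hlu : l ≤ u) (k : ℕ)
    (hl : ∑ i, l i ≤ k) (hu : k ≤ ∑ i, u i) : ∃ κ, l ≤ κ ∧ κ ≤ u ∧ ∑ i, κ i = k := by
  classical
  induction k, hl using Nat.le_induction with
  | base => exact ⟨l, le_rfl, hlu, rfl⟩
  | succ k _ ih =>
    obtain ⟨κ, h1, h2, h3⟩ := ih (by omega)
    obtain ⟨i, -, hi⟩ := Finset.exists_lt_of_sum_lt (s := Finset.univ) (f := κ) (g := u) (by omega)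
    refine ⟨Function.update κ i (κ i + 1), fun j => ?_, fun j => ?_, ?_⟩
    · rcases eq_or_ne j i with rfl | hj
      · rw [Function.update_self]; exact (h1 j).trans (Nat.le_succ _)
      · rw [Function.update_of_ne hj]; exact h1 j
    · rcases eq_or_ne j i with rfl | hj
      · rw [Function.update_self]; exact hi
      · rw [Function.update_of_ne hj]; exact h2 j
    · rw [Finset.sum_update_of_mem (Finset.mem_univ i), ← h3,
        ← Finset.add_sum_erase _ _ (Finset.mem_univ i), Finset.sdiff_singleton_eq_erase]
      omega

/-- Truncating a columnwise sum by `k` can be done by truncating each summand separately. -/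
theorem exists_sum_le_forall_sum_sub {ι : Type*} [Fintype ι] (a : ι → ℕ → ℕ)
    (ha : ∀ i, Antitone (a i)) (M : ℕ) (hM : ∀ i, a i M = 0) (k : ℕ) :
    ∃ κ : ι → ℕ, ∑ i, κ i ≤ k ∧ ∀ j, ∑ i, (a i j - κ i) = ∑ i, a i j - k := by
  classical
  have hex : ∃ m, ∑ i, a i m ≤ k := ⟨M, by simp [hM]⟩
  -- `m` is the first column with total at most `k`; by monotonicity every later column is truncated
  -- to zero on both sides.
  obtain ⟨m, hm, hmin⟩ : ∃ m, ∑ i, a i m ≤ k ∧ ∀ j < m, ¬ ∑ i, a i j ≤ k :=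
    ⟨Nat.find hex, Nat.find_spec hex, fun j => Nat.find_min hex⟩
  have hge (κ : ι → ℕ) (hκ : ∀ i, a i m ≤ κ i) (j : ℕ) (hj : m ≤ j) :
      ∑ i, (a i j - κ i) = ∑ i, a i j - k := by
    rw [Finset.sum_eq_zero fun i _ => Nat.sub_eq_zero_of_le ((ha i hj).trans (hκ i)),
      Nat.sub_eq_zero_of_le ((Finset.sum_le_sum fun i _ => ha i hj).trans hm)]
  cases m with
  | zero => exact ⟨fun i => a i 0, hm, fun j => hge _ (fun _ => le_rfl) j (Nat.zero_le j)⟩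
  | succ m =>
    -- Interpolating between columns `m + 1` and `m` makes `κ` sum to exactly `k`. Up to column `m`
    -- it lies below every entry, so there truncated subtraction is honest subtraction.
    obtain ⟨κ, h1, h2, h3⟩ := exists_sum_eq_of_le_of_le (fun i => a i (m + 1)) (fun i => a i m)
      (fun i => ha i m.le_succ) k hm (not_le.1 (hmin m m.lt_succ_self)).le
    refine ⟨κ, h3.le, fun j => ?_⟩
    by_cases hj : m + 1 ≤ j
    · exact hge κ h1 j hj
    · rw [← h3, Finset.sum_tsub_distrib _ fun i _ => (h2 i).trans (ha i (by omega))]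

end Partition

/-! ### Nilpotent orbits characterised by ranks -/

noncomputable section Orbit

variable {K V : Type*} [Field K] [AddCommGroup V] [Module K V]

/-- Conversely to the rank formula, the condition at `k = n` forces nilpotency, so a Jordan basis
exists, and the ranks then determine its block sizes. -/
theorem mem_nilpotentOrbit_iff [FiniteDimensional K V] {n : ℕ}
    (p : Nat.Partition n) (x : End K V) :
    x ∈ nilpotentOrbit K V p ↔
      ∀ k, finrank K (LinearMap.range (x ^ k)) = ∑ j ∈ Finset.range n, (part p j - k) := by
  have hcard (k : ℕ) : Nat.card ((j : ℕ) × Fin (part p j - k)) =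
      ∑ j ∈ Finset.range n, (part p j - k) :=
    card_sigma_nat _ n fun j hj => by rw [part_eq_zero p hj, Nat.zero_sub]
  refine ⟨fun h k => by rw [HasJordanBlocks.finrank_range_pow h, hcard], fun h => ?_⟩
  have hnil : IsNilpotent x := by
    refine ⟨n, ?_⟩
    rw [← LinearMap.range_eq_bot, ← Submodule.finrank_eq_zero (R := K), h]
    exact Finset.sum_eq_zero fun j _ => Nat.sub_eq_zero_of_le (part_le p j)
  obtain ⟨d, a, ha⟩ := exists_hasJordanBlocks_of_isNilpotent hnil
  have := finite_sigma_nat _ n fun j hj => part_eq_zero p hj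
  refine HasJordanBlocks.of_card_eq (fun k => ?_) ha
  rw [← ha.finrank_range_pow, h, hcard]

theorem hasJordanBlocks_conj {ι : Type*} {x : End K V} {a : ι → ℕ}
    (g : LinearMap.GeneralLinearGroup K V) (h : HasJordanBlocks x a) :
    HasJordanBlocks ((g : End K V) * x * ((g⁻¹ : LinearMap.GeneralLinearGroup K V) : End K V))
      a := by
  obtain ⟨b, h0, h1⟩ := h
  have hg (v : V) : ((g⁻¹ : LinearMap.GeneralLinearGroup K V) : End K V) ((g : End K V) v) = v := by
    rw [← Module.End.mul_apply, Units.inv_mul, Module.End.one_apply]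
  have hb (p) : b.map (LinearMap.GeneralLinearGroup.toLinearEquiv g) p = (g : End K V) (b p) := rfl
  refine ⟨b.map (LinearMap.GeneralLinearGroup.toLinearEquiv g), fun i h => ?_, fun i k h => ?_⟩
  · rw [hb, Module.End.mul_apply, Module.End.mul_apply, hg, h0, map_zero]
  · rw [hb, hb, Module.End.mul_apply, Module.End.mul_apply, hg, h1]

theorem exists_conj_of_hasJordanBlocks {ι : Type*} {x y : End K V} {a : ι → ℕ}
    (hx : HasJordanBlocks x a) (hy : HasJordanBlocks y a) :
    ∃ g : LinearMap.GeneralLinearGroup K V,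
      y = (g : End K V) * x * ((g⁻¹ : LinearMap.GeneralLinearGroup K V) : End K V) := by
  obtain ⟨b, h0, h1⟩ := hx
  obtain ⟨b', h0', h1'⟩ := hy
  let g := LinearMap.GeneralLinearGroup.ofLinearEquiv (b.equiv b' (Equiv.refl _))
  have hg (p) : (g : End K V) (b p) = b' p := Basis.equiv_apply ..
  refine ⟨g, ?_⟩
  have : y * g = g * x := by
    refine b.ext ?_
    rintro ⟨i, k, hk⟩
    rw [Module.End.mul_apply, Module.End.mul_apply, hg]
    cases k with
    | zero => rw [h0, h0', map_zero]
    | succ k => rw [h1, h1', hg]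
  rw [← this, mul_assoc, Units.mul_inv, mul_one]

theorem mem_adSaturation_self {S : Set (End K V)} {x : End K V} (hx : x ∈ S) :
    x ∈ adSaturation S :=
  ⟨1, x, hx, by simp⟩

theorem nilpotentOrbit_eq_adSaturation {n : ℕ} (p : Nat.Partition n) {x : End K V}
    (hx : x ∈ nilpotentOrbit K V p) : nilpotentOrbit K V p = adSaturation {x} := by
  ext y
  constructor
  · intro hy
    obtain ⟨g, hg⟩ := exists_conj_of_hasJordanBlocks hx hy
    exact ⟨g, x, rfl, hg⟩
  · rintro ⟨g, _, rfl, rfl⟩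
    exact hasJordanBlocks_conj g hx

/-- The endomorphism with a given Jordan basis. -/
def jordanShift {ι : Type*} {a : ι → ℕ} (b : Basis ((i : ι) × Fin (a i)) K V) : End K V :=
  b.constr K fun p => if p.2.1 = 0 then 0 else
    b ⟨p.1, ⟨p.2.1 - 1, (Nat.sub_le _ _).trans_lt p.2.2⟩⟩

theorem jordanShift_apply {ι : Type*} {a : ι → ℕ} (b : Basis ((i : ι) × Fin (a i)) K V)
    (p : (i : ι) × Fin (a i)) : jordanShift b (b p) = if p.2.1 = 0 then 0 else
      b ⟨p.1, ⟨p.2.1 - 1, (Nat.sub_le _ _).trans_lt p.2.2⟩⟩ :=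
  b.constr_basis ..

theorem hasJordanBlocks_jordanShift {ι : Type*} {a : ι → ℕ}
    (b : Basis ((i : ι) × Fin (a i)) K V) : HasJordanBlocks (jordanShift b) a :=
  ⟨b, fun i h => by rw [jordanShift_apply]; rfl, fun i k h => by rw [jordanShift_apply]; rfl⟩

theorem nilpotentOrbit_nonempty [FiniteDimensional K V] {n : ℕ} (hn : finrank K V = n)
    (p : Nat.Partition n) : (nilpotentOrbit K V p).Nonempty := by
  have := finite_sigma_nat _ n fun j hj => part_eq_zero p hj
  have hcard : Nat.card ((j : ℕ) × Fin (part p j)) = n := by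
    rw [card_sigma_nat _ n fun j hj => part_eq_zero p hj, sum_range_part p le_rfl]
  let e : Fin n ≃ ((j : ℕ) × Fin (part p j)) := (finCongr hcard).symm.trans (Finite.equivFin _).symm
  exact ⟨_, hasJordanBlocks_jordanShift ((finBasisOfFinrankEq K V hn).reindex e)⟩

theorem finrank_range_conj_pow (g : LinearMap.GeneralLinearGroup K V) (x : End K V) (k : ℕ) :
    finrank K (LinearMap.range (((g : End K V) * x *
      ((g⁻¹ : LinearMap.GeneralLinearGroup K V) : End K V)) ^ k)) =
      finrank K (LinearMap.range (x ^ k)) := by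
  rw [Units.conj_pow, Module.End.mul_eq_comp, LinearMap.range_comp_of_range_eq_top,
    Module.End.mul_eq_comp, LinearMap.range_comp]
  · exact LinearEquiv.finrank_map_eq (LinearMap.GeneralLinearGroup.toLinearEquiv g) _
  · exact LinearEquiv.range (LinearMap.GeneralLinearGroup.toLinearEquiv g⁻¹)

end Orbit

/-! ### Zariski closure and semicontinuity of rank -/

section Zariski

variable {K E V : Type*} [Field K] [AddCommGroup E] [Module K E] [AddCommGroup V] [Module K V]

/-- A polynomial function which detects that the rank of the `k`-th power is at least `r`. -/
theorem exists_polynomial_rank_pow [FiniteDimensional K V] (x : End K V) (k : ℕ) :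
    ∃ f : MvPolynomial (Dual K (End K V)) K,
      MvPolynomial.eval (fun φ : Dual K (End K V) => φ x) f ≠ 0 ∧
      ∀ y : End K V, MvPolynomial.eval (fun φ : Dual K (End K V) => φ y) f ≠ 0 →
        finrank K (LinearMap.range (x ^ k)) ≤ finrank K (LinearMap.range (y ^ k)) := by
  classical
  set r := finrank K (LinearMap.range (x ^ k)) with hr
  let b := finBasis K V
  let c : Basis (Fin r) K (LinearMap.range (x ^ k)) := finBasis K _
  -- a section of the surjection of `V` onto the range and a retraction of the range
  obtain ⟨s, hs⟩ := (x ^ k).rangeRestrict.exists_rightInverse_of_surjective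
    (LinearMap.range_rangeRestrict _)
  obtain ⟨t, ht⟩ := (LinearMap.range (x ^ k)).subtype.exists_leftInverse_of_injective
    (Submodule.ker_subtype _)
  let A := LinearMap.toMatrix c b s
  let B := LinearMap.toMatrix b c t
  let coord (i j) : Dual K (End K V) :=
    { toFun := fun y => LinearMap.toMatrix b b y i j
      map_add' := fun _ _ => by simp
      map_smul' := fun _ _ => by simp }
  let M : Matrix _ _ (MvPolynomial (Dual K (End K V)) K) :=
    Matrix.of fun i j => MvPolynomial.X (coord i j)
  let CK : K →+* MvPolynomial (Dual K (End K V)) K := MvPolynomial.C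
  -- This is `det (t ∘ y ^ k ∘ s)` as a polynomial in the matrix entries of `y`. It is `1` at `y =
  -- x`, and where it is nonzero an `r`-dimensional space factors through `y ^ k`.
  let f := (Matrix.map B CK * M ^ k * Matrix.map A CK).det
  have hf (y : End K V) : MvPolynomial.eval (fun φ : Dual K (End K V) => φ y) f =
      LinearMap.det (t ∘ₗ (y ^ k) ∘ₗ s) := by
    have hM : M.map (MvPolynomial.eval (fun φ : Dual K (End K V) => φ y)) =
        LinearMap.toMatrix b b y := by
      ext i j
      simp [M, coord]
    have hC {m n : Type} (D : Matrix m n K) : (D.map CK).map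
        (MvPolynomial.eval (fun φ : Dual K (End K V) => φ y)) = D := by
      ext i j
      simp [CK]
    rw [RingHom.map_det, RingHom.mapMatrix_apply, Matrix.map_mul, Matrix.map_mul, hC, hC,
      ← RingHom.mapMatrix_apply _ (M ^ k), map_pow, RingHom.mapMatrix_apply, hM,
      ← LinearMap.det_toMatrix c, LinearMap.toMatrix_comp c b c, LinearMap.toMatrix_comp c b b,
      LinearMap.toMatrix_pow, Matrix.mul_assoc]
  refine ⟨f, ?_, fun y hy => ?_⟩
  · rw [hf]
    have : t ∘ₗ (x ^ k) ∘ₗ s = LinearMap.id := by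
      rw [← ht]
      ext v
      have := LinearMap.congr_fun hs v
      have h2 : (x ^ k) (s v) = v := congrArg Subtype.val this
      simp [h2]
    rw [this, LinearMap.det_id]
    exact one_ne_zero
  · rw [hf] at hy
    have h1 : LinearMap.range (t ∘ₗ (y ^ k) ∘ₗ s) = ⊤ :=
      LinearMap.range_eq_top.2 (LinearMap.equivOfDetNeZero _ hy).surjective
    calc r = finrank K (LinearMap.range (t ∘ₗ (y ^ k) ∘ₗ s)) := by rw [h1, finrank_top]
      _ ≤ finrank K (LinearMap.range (t ∘ₗ (y ^ k))) :=
        Submodule.finrank_mono (by rw [← LinearMap.comp_assoc]; exact LinearMap.range_comp_le_range _ _)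
      _ ≤ finrank K (LinearMap.range (y ^ k)) := by
        rw [LinearMap.range_comp]
        exact Submodule.finrank_map_le _ _

/-- Ranks of powers can only drop under Zariski specialization. -/
theorem finrank_range_pow_le_of_mem_zariskiClosure [FiniteDimensional K V] {S : Set (End K V)}
    {x : End K V} (hx : x ∈ zariskiClosure K S) (k m : ℕ)
    (h : ∀ y ∈ S, finrank K (LinearMap.range (y ^ k)) ≤ m) :
    finrank K (LinearMap.range (x ^ k)) ≤ m := by
  obtain ⟨f, hfx, hf⟩ := exists_polynomial_rank_pow x k
  by_contra hlt
  exact hfx (hx f fun y hy => by_contra fun hy0 => hlt ((hf y hy0).trans (h y hy)))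

open Polynomial in
/-- Restriction of a polynomial function to an affine line. -/
theorem exists_polynomial_line (u v : E) (f : MvPolynomial (Dual K E) K) :
    ∃ p : K[X], ∀ t, p.eval t = MvPolynomial.eval (fun φ : Dual K E => φ (u + t • v)) f := by
  refine ⟨MvPolynomial.eval₂ C (fun φ : Dual K E => C (φ u) + X * C (φ v)) f, fun t => ?_⟩
  rw [← coe_evalRingHom, MvPolynomial.hom_eval₂, MvPolynomial.eval]
  congr 1
  · ext a; simp
  · ext φ; simp; exact mul_comm _ _

/-- If some point of a line satisfies finitely many open conditions which imply membership in `S`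
on the line, then the line lies in the Zariski closure of `S`. -/
theorem line_subset_zariskiClosure [Infinite K] {S : Set E} (u v : E) {ι : Type*} (s : Finset ι)
    (f : ι → MvPolynomial (Dual K E) K)
    (hu : ∀ i ∈ s, MvPolynomial.eval (fun φ : Dual K E => φ u) (f i) ≠ 0)
    (hS : ∀ t : K, (∀ i ∈ s, MvPolynomial.eval (fun φ : Dual K E => φ (u + t • v)) (f i) ≠ 0) →
      u + t • v ∈ S) (t : K) : u + t • v ∈ zariskiClosure K S := by
  intro g hg
  choose p hp using exists_polynomial_line (K := K) u v
  rw [← hp]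
  have h0 : ∏ i ∈ s, p (f i) ≠ 0 := Finset.prod_ne_zero_iff.2 fun i hi h => hu i hi (by
    have := hp (f i) 0
    rw [h, Polynomial.eval_zero, zero_smul, add_zero] at this
    exact this.symm)
  -- At each `t` either all the open conditions hold and `g` vanishes, or some factor of the product
  -- does. Over an infinite field the product polynomial is then zero.
  have h1 : p g * ∏ i ∈ s, p (f i) = 0 := by
    refine Polynomial.funext fun t => ?_
    rw [Polynomial.eval_mul, Polynomial.eval_prod, Polynomial.eval_zero]
    by_cases h : ∀ i ∈ s, MvPolynomial.eval (fun φ : Dual K E => φ (u + t • v)) (f i) ≠ 0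
    · rw [hp, hg _ (hS t h), zero_mul]
    · push Not at h
      obtain ⟨i, hi, h⟩ := h
      rw [Finset.prod_eq_zero hi (by rw [hp, h]), mul_zero]
  rw [(mul_eq_zero.1 h1).resolve_right h0, Polynomial.eval_zero]

end Zariski

/-! ### Rank bound for block triangular endomorphisms -/

section Filtration

variable {K V ι : Type*} [Field K] [AddCommGroup V] [Module K V]

theorem pow_mem {z : End K V} {U : Submodule K V} (hz : ∀ v ∈ U, z v ∈ U) (k : ℕ) :
    ∀ v ∈ U, (z ^ k) v ∈ U := by
  induction k with
  | zero => exact fun v hv => hv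
  | succ k ih => exact fun v hv => by rw [pow_succ']; exact hz _ (ih v hv)

/-- Modulo the `z`-stable subspace `U`, `z` acts on `W` as `x` does, and so do the powers. -/
theorem pow_sub_pow_mem {x z : End K V} {W U : Submodule K V} (hx : ∀ v ∈ W, x v ∈ W)
    (hz : ∀ v ∈ U, z v ∈ U) (hxz : ∀ v ∈ W, z v - x v ∈ U) (k : ℕ) :
    ∀ v ∈ W, (z ^ k) v - (x ^ k) v ∈ U := by
  induction k with
  | zero => simp
  | succ k ih =>
    intro v hv
    rw [pow_succ', pow_succ', Module.End.mul_apply, Module.End.mul_apply]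
    have := U.add_mem (hz _ (ih v hv)) (hxz _ (pow_mem hx k v hv))
    rwa [map_sub, sub_add_sub_cancel] at this

/-- For a block triangular endomorphism `z` with diagonal part `x`, the rank of the power of `z`
with exponent `∑ q, κ q` is at most the sum of the ranks of the powers of the diagonal blocks. -/
theorem finrank_map_pow_sum_le [FiniteDimensional K V] [LinearOrder ι] {x z : End K V}
    {W : ι → Submodule K V} (hx : ∀ p, ∀ v ∈ W p, x v ∈ W p)
    (hxz : ∀ p, ∀ v ∈ W p, z v - x v ∈ ⨆ q, ⨆ (_ : q < p), W q) (κ : ι → ℕ) (s : Finset ι)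
    (hs : ∀ p ∈ s, ∀ q < p, q ∈ s) :
    finrank K ((s.sup W).map (z ^ ∑ q ∈ s, κ q)) ≤
      ∑ q ∈ s, finrank K ((W q).map (x ^ κ q)) := by
  induction s using Finset.induction_on_max with
  | empty => rw [Finset.sup_empty, Submodule.map_bot, finrank_bot, Finset.sum_empty]
  | insert a s hlt ih =>
    have hmem : ∀ q, q < a ↔ q ∈ s := fun q => ⟨fun h =>
      (Finset.mem_insert.1 (hs a (Finset.mem_insert_self a s) q h)).resolve_left h.ne, hlt q⟩
    have has : a ∉ s := fun h => lt_irrefl a (hlt a h)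
    have hs' : ∀ p ∈ s, ∀ q < p, q ∈ s := fun p hp q hq => (hmem q).1 (hq.trans (hlt p hp))
    have hle (p : ι) (hp : p ∈ insert a s) : (⨆ q, ⨆ (_ : q < p), W q) ≤ s.sup W := by
      refine iSup₂_le fun q hq => Finset.le_sup ((hmem q).1 ?_)
      rcases Finset.mem_insert.1 hp with rfl | hp
      · exact hq
      · exact hq.trans (hlt p hp)
    have hz : ∀ v ∈ s.sup W, z v ∈ s.sup W := by
      have : s.sup W ≤ (s.sup W).comap z := by
        refine Finset.sup_le fun p hp v hv => ?_
        have h1 := hle p (Finset.mem_insert_of_mem hp) (hxz p v hv)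
        have h2 : x v ∈ s.sup W := Finset.le_sup (f := W) hp (hx p v hv)
        simpa using Submodule.add_mem _ h1 h2
      exact this
    have hdiff := pow_sub_pow_mem (hx a) hz
      (fun v hv => hle a (Finset.mem_insert_self a s) (hxz a v hv)) (κ a)
    rw [Finset.sup_insert, Finset.sum_insert has, Finset.sum_insert has, add_comm (κ a),
      add_comm (finrank K _)]
    -- The first `κ a` factors of `z` send `W a` into `x ^ κ a (W a)` plus lower blocks. The
    -- remaining factors are left for the lower blocks, and cannot raise the dimension of the image
    -- of `x ^ κ a (W a)`.
    have hsub : (W a ⊔ s.sup W).map (z ^ (∑ q ∈ s, κ q + κ a)) ≤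
        (s.sup W).map (z ^ ∑ q ∈ s, κ q) ⊔
          ((W a).map (x ^ κ a)).map (z ^ ∑ q ∈ s, κ q) := by
      rw [pow_add, Module.End.mul_eq_comp, Submodule.map_comp, ← Submodule.map_sup]
      refine Submodule.map_mono ?_
      rw [Submodule.map_sup, sup_le_iff]
      constructor
      · rintro _ ⟨v, hv, rfl⟩
        rw [← sub_add_cancel ((z ^ κ a) v) ((x ^ κ a) v)]
        exact Submodule.add_mem_sup (hdiff v hv) (Submodule.mem_map_of_mem hv)
      · refine le_trans ?_ le_sup_left
        rintro _ ⟨v, hv, rfl⟩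
        exact pow_mem hz _ v hv
    calc _ ≤ _ := Submodule.finrank_mono hsub
      _ ≤ _ := Submodule.finrank_add_le_finrank_add_finrank _ _
      _ ≤ _ := add_le_add (ih hs') (Submodule.finrank_map_le _ _)

end Filtration

/-! ### Concatenating Jordan blocks; the bound for induced type -/

section Induction

variable {K V : Type*} [Field K] [AddCommGroup V] [Module K V]

/-- In the lexicographic enumeration, whatever precedes the first position of segment `p` lies in an
earlier segment. This makes the links between concatenated chains strictly triangular. -/
theorem lt_of_finSigmaFinEquiv_lt {m : ℕ} {n : Fin m → ℕ} {p q : Fin m} {k : Fin (n p)}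
    {l : Fin (n q)} (hk : (k : ℕ) = 0)
    (h : (finSigmaFinEquiv ⟨q, l⟩ : ℕ) < finSigmaFinEquiv ⟨p, k⟩) : q < p := by
  by_contra hpq
  have hsum (i : Fin m) : ∑ j : Fin i, n (Fin.castLE i.2.le j) =
      ∑ j ∈ Finset.range i, if h : j < m then n ⟨j, h⟩ else 0 := by
    rw [← Fin.sum_univ_eq_sum_range (fun j => if h : j < m then n ⟨j, h⟩ else 0)]
    exact Finset.sum_congr rfl fun j _ => by rw [dif_pos (j.2.trans i.2)]; rfl
  have hle := Finset.sum_le_sum_of_subset (f := fun j => if h : j < m then n ⟨j, h⟩ else 0)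
    (Finset.range_mono (not_lt.1 hpq : (p : ℕ) ≤ q))
  rw [finSigmaFinEquiv_apply, finSigmaFinEquiv_apply] at h
  simp only [hsum, hk] at h
  omega

/-- Concatenation of the `j`-th blocks of a finite sequence of block families. -/
def blockConcatEquiv {r : ℕ} (a : Fin r → ℕ → ℕ) :
    ((p : Fin r) × (j : ℕ) × Fin (a p j)) ≃ ((j : ℕ) × Fin (∑ p, a p j)) where
  toFun s := ⟨s.2.1, finSigmaFinEquiv (n := fun p => a p s.2.1) ⟨s.1, s.2.2⟩⟩
  invFun s := ⟨(finSigmaFinEquiv.symm s.2).1, s.1, (finSigmaFinEquiv.symm s.2).2⟩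
  left_inv := by
    rintro ⟨p, j, k⟩
    have h := finSigmaFinEquiv.symm_apply_apply (⟨p, k⟩ : (p : Fin r) × Fin (a p j))
    exact congrArg (fun s : (p : Fin r) × Fin (a p j) =>
      (⟨s.1, j, s.2⟩ : (p : Fin r) × (j : ℕ) × Fin (a p j))) h
  right_inv := by
    rintro ⟨j, k⟩
    exact congrArg (Sigma.mk j) (finSigmaFinEquiv.apply_symm_apply k)

/-- A block diagonal nilpotent endomorphism can be modified above the diagonal in such a way that
its Jordan blocks are concatenated. -/
theorem exists_hasJordanBlocks_sum {r : ℕ} {W : Fin r → Submodule K V}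
    (hW : DirectSum.IsInternal W) {x : End K V} (hx : ∀ p, ∀ v ∈ W p, x v ∈ W p)
    (a : Fin r → ℕ → ℕ) (ha : ∀ p, HasJordanBlocks (x.restrict (hx p)) (a p)) :
    ∃ z : End K V, HasJordanBlocks z (fun j => ∑ p, a p j) ∧
      ∀ p, ∀ v ∈ W p, z v - x v ∈ ⨆ q, ⨆ (_ : q < p), W q := by
  choose b h0 h1 using ha
  obtain ⟨e, he⟩ : ∃ e : ((p : Fin r) × (j : ℕ) × Fin (a p j)) ≃ ((j : ℕ) × Fin (∑ p, a p j)),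
      ∀ p j k, e ⟨p, j, k⟩ = ⟨j, finSigmaFinEquiv (n := fun p => a p j) ⟨p, k⟩⟩ :=
    ⟨blockConcatEquiv a, fun _ _ _ => rfl⟩
  obtain ⟨B, hBe⟩ : ∃ B, B = (hW.collectedBasis b).reindex e := ⟨_, rfl⟩
  have hB (p : Fin r) (j : ℕ) (k : Fin (a p j)) : B (e ⟨p, j, k⟩) = b p ⟨j, k⟩ := by
    rw [hBe, Basis.reindex_apply, Equiv.symm_apply_apply, hW.collectedBasis_coe]
  refine ⟨jordanShift B, hasJordanBlocks_jordanShift B, fun p => ?_⟩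
  have hU (q : Fin r) (hq : q < p) : W q ≤ ⨆ q, ⨆ (_ : q < p), W q := le_iSup₂_of_le q hq le_rfl
  -- Only the inclusions `W q ≤ U` for `q < p` matter from here on.
  generalize (⨆ q, ⨆ (_ : q < p), W q) = U at hU ⊢
  have hbasis (s : (j : ℕ) × Fin (a p j)) :
      jordanShift B (b p s) - x (b p s) ∈ U := by
    obtain ⟨j, k, hk⟩ := s
    cases k with
    | zero =>
      have hx0 : x (b p ⟨j, ⟨0, hk⟩⟩) = 0 := congrArg Subtype.val (h0 p j hk)
      rw [hx0, sub_zero, ← hB, he, jordanShift_apply]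
      split_ifs with hidx
      · exact U.zero_mem
      -- The start of a chain of `W p`, killed by `x`, is now sent to the preceding vector of the
      -- concatenated chain, which belongs to some `W q` with `q < p`.
      · generalize_proofs hlt
        obtain ⟨⟨q, j', l⟩, hq⟩ := e.surjective ⟨j, ⟨_, hlt⟩⟩
        rw [← hq, hB]
        rw [he] at hq
        obtain rfl : j' = j := congrArg Sigma.fst hq
        have hval : (finSigmaFinEquiv (n := fun p => a p j') ⟨q, l⟩ : ℕ) =
            (finSigmaFinEquiv (n := fun p => a p j') ⟨p, ⟨0, hk⟩⟩ : ℕ) - 1 :=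
          congrArg Fin.val (eq_of_heq (Sigma.mk.inj hq).2)
        have hqp : q < p := lt_of_finSigmaFinEquiv_lt rfl (by
          rw [hval]
          exact Nat.sub_lt (Nat.pos_of_ne_zero hidx) one_pos)
        exact hU q hqp (b q ⟨j', l⟩).2
    | succ k =>
      have hx1 : x (b p ⟨j, ⟨k + 1, hk⟩⟩) = b p ⟨j, ⟨k, (Nat.lt_succ_self k).trans hk⟩⟩ :=
        congrArg Subtype.val (h1 p j k hk)
      have hval : (finSigmaFinEquiv (n := fun p => a p j) ⟨p, ⟨k + 1, hk⟩⟩ : ℕ) =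
          finSigmaFinEquiv (n := fun p => a p j) ⟨p, ⟨k, (Nat.lt_succ_self k).trans hk⟩⟩ + 1 := by
        rw [finSigmaFinEquiv_apply, finSigmaFinEquiv_apply]
        rfl
      have hlt : (finSigmaFinEquiv (n := fun p => a p j)
          ⟨p, ⟨k, (Nat.lt_succ_self k).trans hk⟩⟩ : ℕ) + 1 < ∑ p, a p j := hval ▸ Fin.is_lt _
      have hstep : e ⟨p, j, ⟨k + 1, hk⟩⟩ = ⟨j, ⟨_, hlt⟩⟩ := by
        rw [he]
        exact congrArg (Sigma.mk j) (Fin.ext hval)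
      have hz : jordanShift B (B ⟨j, ⟨_, hlt⟩⟩) =
          B (e ⟨p, j, ⟨k, (Nat.lt_succ_self k).trans hk⟩⟩) := by
        rw [jordanShift_apply, he]
        rfl
      rw [hx1, ← hB, hstep, hz, hB, sub_self]
      exact U.zero_mem
  intro v hv
  have hspan : (⊤ : Submodule K (W p)) ≤ U.comap ((jordanShift B - x) ∘ₗ (W p).subtype) := by
    rw [← (b p).span_eq, Submodule.span_le]
    rintro _ ⟨s, rfl⟩
    rw [SetLike.mem_coe, Submodule.mem_comap, LinearMap.comp_apply, Submodule.subtype_apply,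
      LinearMap.sub_apply]
    exact hbasis s
  have hmem := Submodule.mem_comap.1 (hspan (Submodule.mem_top (x := ⟨v, hv⟩)))
  rwa [LinearMap.comp_apply, Submodule.subtype_apply, LinearMap.sub_apply] at hmem

theorem finrank_range_restrict_pow {W : Submodule K V} {x : End K V} (hx : ∀ v ∈ W, x v ∈ W)
    (k : ℕ) : finrank K (LinearMap.range ((x.restrict hx) ^ k)) = finrank K (W.map (x ^ k)) := by
  rw [Module.End.pow_restrict, ← Submodule.finrank_map_subtype_eq, ← LinearMap.range_comp,
    LinearMap.subtype_comp_restrict, LinearMap.domRestrict, LinearMap.range_comp,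
    Submodule.range_subtype]

/-- The block triangular bound is applied with the exponents `κ` for which truncation commutes with
column sums; as `∑ κ ≤ k`, passing from `z ^ ∑ κ` to `z ^ k` only shrinks the range. -/
theorem finrank_range_pow_le_sum [FiniteDimensional K V] {r : ℕ} {W : Fin r → Submodule K V}
    (hW : DirectSum.IsInternal W) {x z : End K V} (hx : ∀ p, ∀ v ∈ W p, x v ∈ W p)
    (hxz : ∀ p, ∀ v ∈ W p, z v - x v ∈ ⨆ q, ⨆ (_ : q < p), W q)
    (a : Fin r → ℕ → ℕ) (hanti : ∀ p, Antitone (a p)) (M : ℕ) (hM : ∀ p, a p M = 0)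
    (ha : ∀ p, HasJordanBlocks (x.restrict (hx p)) (a p)) (k : ℕ) :
    finrank K (LinearMap.range (z ^ k)) ≤ ∑ j ∈ Finset.range M, (∑ p, a p j - k) := by
  obtain ⟨κ, hκ, hsum⟩ := exists_sum_le_forall_sum_sub a hanti M hM k
  have htop : Finset.univ.sup W = ⊤ := by
    rw [Finset.sup_univ_eq_iSup, hW.submodule_iSup_eq_top]
  have h1 := finrank_map_pow_sum_le hx hxz κ Finset.univ fun _ _ _ _ => Finset.mem_univ _
  rw [htop, ← LinearMap.range_eq_map] at h1
  calc finrank K (LinearMap.range (z ^ k))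
      ≤ finrank K (LinearMap.range (z ^ ∑ p, κ p)) := by
        refine Submodule.finrank_mono ?_
        rw [← Nat.add_sub_cancel' hκ, pow_add]
        exact LinearMap.range_comp_le_range _ _
    _ ≤ ∑ p, finrank K ((W p).map (x ^ κ p)) := h1
    _ = ∑ p, ∑ j ∈ Finset.range M, (a p j - κ p) := by
        refine Finset.sum_congr rfl fun p _ => ?_
        rw [← finrank_range_restrict_pow (hx p), (ha p).finrank_range_pow,
          card_sigma_nat _ M fun j hj => ?_]
        rw [Nat.eq_zero_of_le_zero ((hanti p hj).trans (hM p).le), Nat.zero_sub]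
    _ = _ := by
        rw [Finset.sum_comm]
        exact Finset.sum_congr rfl fun j _ => hsum j

end Induction

/-! ### Flags whose parabolic has the given Levi factor -/

section Flag

variable {K V ι : Type*} [Field K] [AddCommGroup V] [Module K V]

theorem exists_projections [Fintype ι] [DecidableEq ι] {W : ι → Submodule K V}
    (hW : DirectSum.IsInternal W) :
    ∃ π : (i : ι) → V →ₗ[K] W i, (∀ i (v : W i), π i v = v) ∧
      (∀ i j, i ≠ j → ∀ v ∈ W j, π i v = 0) ∧ ∀ v, ∑ i, (π i v : V) = v := by
  classical
  let e := LinearEquiv.ofBijective (DirectSum.coeLinearMap W) hW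
  have he (i : ι) (v : W i) : e.symm v = DirectSum.lof K ι (fun i => W i) i v := by
    rw [LinearEquiv.symm_apply_eq]
    exact (DirectSum.coeLinearMap_lof W i v).symm
  refine ⟨fun i => DirectSum.component K ι (fun i => W i) i ∘ₗ e.symm.toLinearMap,
    fun i v => ?_, fun i j hij v hv => ?_, fun v => ?_⟩
  · simp [he, DirectSum.component.lof_self]
  · simp only [LinearMap.comp_apply, LinearEquiv.coe_coe, he j ⟨v, hv⟩,
      DirectSum.component.of]
    rw [dif_neg hij.symm]
  · conv_rhs => rw [← e.apply_symm_apply v]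
    change _ = DirectSum.coeLinearMap W (e.symm v)
    rw [DirectSum.coeLinearMap_eq_dfinsuppSum, DFinsupp.sum_eq_sum_fintype _ (by simp)]
    rfl

/-- If a flag defines a parabolic subalgebra with Levi factor `⨁ gl(W i)`, then the members of the
flag are the sums of initial segments of the `W i` with respect to some ordering. -/
theorem exists_flag_order [Fintype ι] [DecidableEq ι] {W : ι → Submodule K V}
    (hW : DirectSum.IsInternal W) (hne : ∀ i, W i ≠ ⊥) (F : PartialFlag K V)
    (hF : IsLeviFactor (stabilizer W) F) :
    ∃ σ : ι ≃ Fin F.len, ∀ k, F.space k = ⨆ i, ⨆ (_ : (σ i).castSucc < k), W i := by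
  obtain ⟨π, hπ, hπ0, hπs⟩ := exists_projections hW
  have hpar (x : End K V) (hx : ∀ i, ∀ v ∈ W i, x v ∈ W i) :
      ∀ k, ∀ v ∈ F.space k, x v ∈ F.space k := by
    have h : (stabilizer W).toSubmodule ≤ F.parabolic.toSubmodule := hF.2 ▸ le_sup_left
    exact h (show x ∈ (stabilizer W).toSubmodule from hx)
  -- The projection onto `W i` lies in the Levi subalgebra, hence preserves the flag.
  have hproj (i k) (v : V) (hv : v ∈ F.space k) : (π i v : V) ∈ F.space k := by
    refine hpar ((W i).subtype ∘ₗ π i) (fun j w hw => ?_) k v hv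
    rcases eq_or_ne i j with rfl | hij
    · exact (π i w).2
    · rw [LinearMap.comp_apply, hπ0 i j hij w hw]
      exact (W j).zero_mem
  -- Rank one maps inside `W i` are also in the Levi subalgebra, so a nonzero `i`-th component of a
  -- vector of `F_k` would generate all of `W i` within `F_k`.
  have hzero (i k) (hik : ¬ W i ≤ F.space k) (v : V) (hv : v ∈ F.space k) : π i v = 0 := by
    by_contra hw
    obtain ⟨f, hf⟩ := Projective.exists_dual_eq_one K hw
    refine hik fun w' hw' => ?_
    have := hpar ((f ∘ₗ π i).smulRight w') (fun j u hu => ?_) k _ (hproj i k v hv)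
    · rwa [LinearMap.smulRight_apply, LinearMap.comp_apply, hπ, hf, one_smul] at this
    · rcases eq_or_ne i j with rfl | hij
      · exact (W i).smul_mem _ hw'
      · rw [LinearMap.smulRight_apply, LinearMap.comp_apply, hπ0 i j hij u hu, map_zero, zero_smul]
        exact (W j).zero_mem
  have hlvl (i : ι) : ∃ k : Fin F.len, W i ≤ F.space k.succ ∧ ¬ W i ≤ F.space k.castSucc := by
    by_contra! hcon
    have : ∀ k, ¬ W i ≤ F.space k := fun k => by
      induction k using Fin.induction with
      | zero => rw [F.space_zero, le_bot_iff]; exact hne i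
      | succ k ih => exact fun h => ih (hcon k h)
    exact this (Fin.last _) (F.space_last ▸ le_top)
  choose lvl hl1 hl2 using hlvl
  have hspace (k) : F.space k = ⨆ i, ⨆ (_ : (lvl i).castSucc < k), W i := by
    apply le_antisymm
    · intro v hv
      rw [← hπs v]
      refine Submodule.sum_mem _ fun i _ => ?_
      by_cases hik : (lvl i).castSucc < k
      · exact (le_iSup₂_of_le i hik le_rfl : W i ≤ ⨆ i, ⨆ (_ : (lvl i).castSucc < k), W i)
          (π i v).2
      · rw [hzero i k (fun h => hl2 i (h.trans (F.strictMono.monotone (not_lt.1 hik)))) v hv]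
        exact Submodule.zero_mem _
    · exact iSup₂_le fun i hik =>
        (hl1 i).trans (F.strictMono.monotone (Fin.castSucc_lt_iff_succ_le.1 hik))
  -- If `W i` and `W j` entered the flag at the same step, a map `T` from `W i` to `W j` would
  -- stabilise the flag. In `T = p + q`, the Levi part `p` keeps `w` in `W i` and `q w` has no
  -- `j`-component, whereas `T w = w'` is a nonzero vector of `W j`.
  have hinj : Function.Injective lvl := by
    intro i j hij
    by_contra hne'
    obtain ⟨w, hw⟩ := Submodule.nonzero_mem_of_bot_lt (bot_lt_iff_ne_bot.2 (hne i))
    obtain ⟨w', hw'⟩ := Submodule.nonzero_mem_of_bot_lt (bot_lt_iff_ne_bot.2 (hne j))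
    obtain ⟨f, hf⟩ := Projective.exists_dual_eq_one K hw
    let T : End K V := (f ∘ₗ π i).smulRight (w' : V)
    have hTw : T w = w' := by
      rw [LinearMap.smulRight_apply, LinearMap.comp_apply, hπ, hf, one_smul]
    have hT : T ∈ F.parabolic.toSubmodule := by
      intro k v hv
      by_cases hk : W i ≤ F.space k
      · have hjk : (lvl j).castSucc < k := by
          rw [← hij]
          by_contra h
          exact hl2 i (hk.trans (F.strictMono.monotone (not_lt.1 h)))
        exact (F.space k).smul_mem _ ((hl1 j).trans
          (F.strictMono.monotone (Fin.castSucc_lt_iff_succ_le.1 hjk)) w'.2)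
      · rw [LinearMap.smulRight_apply, LinearMap.comp_apply, hzero i k hk v hv, map_zero, zero_smul]
        exact Submodule.zero_mem _
    rw [← hF.2] at hT
    obtain ⟨p, hp, q, hq, hpq⟩ := Submodule.mem_sup.1 hT
    have hpw : p w ∈ W i := hp i w w.2
    have hqw : q w ∈ F.space (lvl i).castSucc := hq (lvl i) w (hl1 i w.2)
    have h1 := hzero j (lvl i).castSucc (hij ▸ hl2 j) _ hqw
    have h2 : q w = w' - p w := by rw [← hTw, ← hpq, LinearMap.add_apply, add_sub_cancel_left]
    rw [h2, map_sub, hπ, hπ0 j i (Ne.symm hne') _ hpw, sub_zero] at h1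
    exact hw' h1
  -- A step at which no `W i` enters would not enlarge the flag, against strictness.
  have hsurj : Function.Surjective lvl := by
    intro k
    by_contra hk
    refine (F.strictMono (Fin.castSucc_lt_succ (i := k))).ne ?_
    rw [hspace, hspace]
    refine iSup_congr fun i => iSup_congr_Prop ?_ fun _ => rfl
    have : lvl i ≠ k := fun h => hk ⟨i, h⟩
    rw [Fin.castSucc_lt_castSucc_iff, Fin.castSucc_lt_succ_iff]
    exact ⟨le_of_lt, fun h => lt_of_le_of_ne h this⟩
  exact ⟨Equiv.ofBijective lvl ⟨hinj, hsurj⟩, hspace⟩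

theorem mem_nilradical_iff {F : PartialFlag K V} {W : Fin F.len → Submodule K V}
    (hW : ∀ k, F.space k = ⨆ p, ⨆ (_ : p.castSucc < k), W p) (y : End K V) :
    y ∈ F.nilradical ↔ ∀ p, ∀ v ∈ W p, y v ∈ ⨆ q, ⨆ (_ : q < p), W q := by
  have hc (p : Fin F.len) : F.space p.castSucc = ⨆ q, ⨆ (_ : q < p), W q := by
    rw [hW]
    rfl
  constructor
  · intro hy p v hv
    rw [← hc]
    refine hy p v ?_
    rw [hW]
    exact (le_iSup₂_of_le p Fin.castSucc_lt_succ le_rfl :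
      W p ≤ ⨆ q, ⨆ (_ : q.castSucc < p.succ), W q) hv
  · intro hy p v hv
    have : F.space p.succ ≤ (F.space p.castSucc).comap y := by
      rw [hW p.succ]
      refine iSup₂_le fun q hq w hw => ?_
      have hqp : q.castSucc ≤ p.castSucc := Fin.castSucc_lt_succ_iff.1 hq
      exact F.strictMono.monotone hqp (hc q ▸ hy q w hw)
    exact this hv

theorem leviNilpotentOrbit_nonempty [FiniteDimensional K V] [Fintype ι] [DecidableEq ι]
    {W : ι → Submodule K V} (hW : DirectSum.IsInternal W) {d : ι → ℕ}
    (hd : ∀ i, finrank K (W i) = d i) (μ : (i : ι) → Nat.Partition (d i)) :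
    (leviNilpotentOrbit W μ).Nonempty := by
  obtain ⟨π, hπ, hπ0, -⟩ := exists_projections hW
  choose y hy using fun i => nilpotentOrbit_nonempty (hd i) (μ i)
  let x : End K V := ∑ i, (W i).subtype ∘ₗ y i ∘ₗ π i
  have hx (i : ι) (v : W i) : x v = y i v := by
    rw [LinearMap.sum_apply, Finset.sum_eq_single i]
    · simp [hπ]
    · intro j _ hj
      simp [hπ0 j i hj v v.2]
    · simp
  have hmem : x ∈ stabilizer W := fun i v hv => by
    rw [hx i ⟨v, hv⟩]
    exact (y i _).2
  refine ⟨x, hmem, fun i => ?_⟩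
  convert hy i
  ext v
  exact hx i v

end Flag

/-! ### Existence and uniqueness of the dense orbit -/

section Main

variable {K V : Type*} [Field K] [AddCommGroup V] [Module K V] [FiniteDimensional K V]

/-- If a nilpotent orbit bounds the ranks of powers on `S + 𝔫`, and every coset `x + 𝔫` with
`x ∈ S` meets it, then it is Zariski dense in the saturation of `S + 𝔫`. -/
theorem adSaturation_subset_zariskiClosure [Infinite K] {n : ℕ} (p : Nat.Partition n)
    {S : Set (End K V)} {𝔫 : LieSubalgebra K (End K V)}
    (hle : ∀ x ∈ S, ∀ y ∈ 𝔫, ∀ k, finrank K (LinearMap.range ((x + y) ^ k)) ≤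
      ∑ j ∈ Finset.range n, (part p j - k))
    (hex : ∀ x ∈ S, ∃ y ∈ 𝔫, x + y ∈ nilpotentOrbit K V p) :
    adSaturation {z | ∃ x ∈ S, ∃ y ∈ 𝔫, z = x + y} ⊆
      zariskiClosure K (nilpotentOrbit K V p) := by
  rintro _ ⟨g, _, ⟨x, hx, y, hy, rfl⟩, rfl⟩
  obtain ⟨y₀, hy₀, hxy₀⟩ := hex x hx
  let c (w : End K V) : End K V :=
    (g : End K V) * w * ((g⁻¹ : LinearMap.GeneralLinearGroup K V) : End K V)
  have hline (t : K) : c (x + y₀) + t • c (y - y₀) = c (x + (y₀ + t • (y - y₀))) := by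
    simp only [c]
    rw [← smul_mul_assoc, ← mul_smul_comm, ← add_mul, ← mul_add, add_assoc]
  have hmem (t : K) : y₀ + t • (y - y₀) ∈ 𝔫 :=
    𝔫.add_mem hy₀ (𝔫.smul_mem t (𝔫.sub_mem hy hy₀))
  choose f hf hfle using fun k => exists_polynomial_rank_pow (c (x + y₀)) k
  have hrank (k : ℕ) : finrank K (LinearMap.range (c (x + y₀) ^ k)) =
      ∑ j ∈ Finset.range n, (part p j - k) := by
    rw [finrank_range_conj_pow]
    exact (mem_nilpotentOrbit_iff p _).1 hxy₀ k
  have key := line_subset_zariskiClosure (S := nilpotentOrbit K V p) (c (x + y₀)) (c (y - y₀))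
    (Finset.range n) f (fun k _ => hf k) (fun t ht => ?_) 1
  · rw [hline, one_smul, add_sub_cancel] at key
    exact key
  · rw [mem_nilpotentOrbit_iff]
    intro k
    have hupper : finrank K (LinearMap.range ((c (x + y₀) + t • c (y - y₀)) ^ k)) ≤
        ∑ j ∈ Finset.range n, (part p j - k) := by
      rw [hline, finrank_range_conj_pow]
      exact hle x hx _ (hmem t) k
    refine le_antisymm hupper ?_
    -- For `k ≥ n` the required rank is zero, so finitely many open conditions suffice.
    by_cases hk : k < n
    · rw [← hrank]
      exact hfle k _ (ht k (Finset.mem_range.2 hk))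
    · rw [Finset.sum_eq_zero fun j _ =>
        Nat.sub_eq_zero_of_le ((part_le p j).trans (not_lt.1 hk))]
      exact Nat.zero_le _

/-- Any other dense orbit has the same ranks: it lies in the saturation, which bounds them above,
and its closure contains the orbit of `p`, which bounds them below. -/
theorem isInducedOrbit_iff_eq_nilpotentOrbit [Infinite K] {n : ℕ} (p : Nat.Partition n)
    (F : PartialFlag K V) {S : Set (End K V)} (hS : S.Nonempty)
    (hle : ∀ x ∈ S, ∀ y ∈ F.nilradical, ∀ k, finrank K (LinearMap.range ((x + y) ^ k)) ≤
      ∑ j ∈ Finset.range n, (part p j - k))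
    (hex : ∀ x ∈ S, ∃ y ∈ F.nilradical, x + y ∈ nilpotentOrbit K V p) (O : Set (End K V)) :
    IsInducedOrbit F S O ↔ O = nilpotentOrbit K V p := by
  obtain ⟨x₀, hx₀⟩ := hS
  obtain ⟨y₀, hy₀, h₀⟩ := hex x₀ hx₀
  have hsub : nilpotentOrbit K V p ⊆ adSaturation {z | ∃ x ∈ S, ∃ y ∈ F.nilradical, z = x + y} := by
    rw [nilpotentOrbit_eq_adSaturation p h₀]
    rintro _ ⟨g, _, rfl, rfl⟩
    exact ⟨g, _, ⟨x₀, hx₀, y₀, hy₀, rfl⟩, rfl⟩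
  constructor
  · rintro ⟨⟨w, rfl⟩, hO, hdense⟩
    suffices hw : w ∈ nilpotentOrbit K V p from (nilpotentOrbit_eq_adSaturation p hw).symm
    rw [mem_nilpotentOrbit_iff]
    intro k
    apply le_antisymm
    · obtain ⟨g, _, ⟨x, hx, y, hy, rfl⟩, hg⟩ := hO (mem_adSaturation_self rfl)
      rw [hg, finrank_range_conj_pow]
      exact hle x hx y hy k
    · rw [← (mem_nilpotentOrbit_iff p _).1 h₀ k]
      refine finrank_range_pow_le_of_mem_zariskiClosure (hdense (hsub h₀)) k _ ?_
      rintro _ ⟨g, _, rfl, rfl⟩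
      rw [finrank_range_conj_pow]
  · rintro rfl
    exact ⟨⟨_, nilpotentOrbit_eq_adSaturation p h₀⟩, hsub,
      adSaturation_subset_zariskiClosure p hle hex⟩

end Main

end InducedOrbit

/-- Let `V = K^N = ⨁ W i` with `dim W i = λ_i`, let `𝔤_λ = ⨁ gl(W i)` be the corresponding Levi
subalgebra of `gl_N(K)` and `O_μ` its nilpotent orbit of type `(μ_1, …, μ_n)`. For every parabolic
subalgebra with Levi factor `𝔤_λ`, the orbit induced from `(𝔤_λ, O_μ)` exists, is unique, and is
the nilpotent orbit with partition `μ^Σ`. -/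
theorem mainTheorem5 {K : Type*} [Field K] [IsAlgClosed K] {N : ℕ} (c : Composition N)
    (μ : (i : Fin c.length) → Nat.Partition (c.blocksFun i))
    (W : Fin c.length → Submodule K (Fin N → K)) (hW : DirectSum.IsInternal W)
    (hdim : ∀ i, Module.finrank K (W i) = c.blocksFun i)
    (F : InducedOrbit.PartialFlag K (Fin N → K))
    (hF : InducedOrbit.IsLeviFactor (InducedOrbit.stabilizer W) F)
    (O : Set (Module.End K (Fin N → K))) :
    InducedOrbit.IsInducedOrbit F (InducedOrbit.leviNilpotentOrbit W μ) O ↔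
      O = InducedOrbit.nilpotentOrbit K (Fin N → K) (InducedOrbit.sigmaPartition c μ) := by
  open InducedOrbit in
  have : Infinite K := IsAlgClosed.instInfinite
  have hne (i) : W i ≠ ⊥ := fun h => by
    have h1 := c.one_le_blocksFun i
    rw [← hdim, h, finrank_bot] at h1
    exact absurd h1 (by decide)
  obtain ⟨σ, hσ⟩ := exists_flag_order hW hne F hF
  have hW' : DirectSum.IsInternal fun p => W (σ.symm p) := by
    rw [DirectSum.isInternal_submodule_iff_iSupIndep_and_iSup_eq_top] at hW ⊢
    exact ⟨hW.1.comp σ.symm.injective, by rw [← hW.2]; exact σ.symm.iSup_comp⟩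
  have hspace (k) : F.space k = ⨆ p, ⨆ (_ : p.castSucc < k), W (σ.symm p) := by
    rw [hσ, ← σ.symm.iSup_comp]
    simp only [Equiv.apply_symm_apply]
  have hnil := mem_nilradical_iff hspace
  let a (p : Fin F.len) : ℕ → ℕ := part (μ (σ.symm p))
  -- Column sums ignore the order in which the flag lists the blocks, whence the independence of the
  -- parabolic.
  have hsum (j : ℕ) : ∑ p, a p j = ∑ i, part (μ i) j :=
    σ.symm.sum_comp fun i => part (μ i) j
  refine isInducedOrbit_iff_eq_nilpotentOrbit _ F (leviNilpotentOrbit_nonempty hW hdim μ) ?_ ?_ O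
  · rintro x ⟨hx, hxμ⟩ y hy k
    rw [sum_part_sigmaPartition]
    simp only [← hsum]
    exact finrank_range_pow_le_sum hW' (fun p => hx (σ.symm p))
      (fun p v hv => by
        rw [LinearMap.add_apply, add_sub_cancel_left]
        exact (hnil y).1 hy p v hv)
      a (fun p => part_antitone _) N (fun p => part_eq_zero _ (c.blocksFun_le _))
      (fun p => hxμ (σ.symm p)) k
  · rintro x ⟨hx, hxμ⟩
    obtain ⟨z, hz, hzx⟩ := exists_hasJordanBlocks_sum hW' (fun p => hx (σ.symm p)) a
      fun p => hxμ (σ.symm p)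
    refine ⟨z - x, (hnil _).2 hzx, ?_⟩
    rw [add_sub_cancel, mem_nilpotentOrbit_iff]
    intro k
    rw [sum_part_sigmaPartition, hz.finrank_range_pow, card_sigma_nat _ N fun j hj => ?_]
    · simp only [hsum]
    · rw [Finset.sum_eq_zero fun p _ => part_eq_zero _ ((c.blocksFun_le _).trans hj), Nat.zero_sub]
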